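/- A matrix query language $\mathsf{ML}(\mathcal L)$, for a set $\mathcal L$ of operations, consists of the well-typed expressions $e(X)$ built with the operations in $\mathcal L$ from a single variable $X$, which stands for a square complex matrix of arbitrary order. The operations are: matrix multiplication $\cdot$; conjugate transposition ${}^*$; the one-vector $\mathbb 1(\cdot)$, mapping an $m\times k$ matrix to the all-ones vector in $\mathbb C^{m\times 1}$; $\mathsf{diag}$, mapping a vector in $\mathbb C^{m\times 1}$ to the diagonal $m\times m$ matrix with that diagonal; the trace $\mathsf{tr}$ of a square matrix; addition $+$ of matrices of the same dimensions; scalar multiplication $\times$ by arbitrary constants $c\in\mathbb C$; and, for a function $f:\mathbb C^p\to\mathbb C$, the entrywise applications $\mathsf{Apply}_{\mathsf s}[f](e_1,\ldots,e_p)$ to scalars ($1\times 1$ matrices) and $\mathsf{Apply}_{\mathsf v}[f](e_1,\ldots,e_p)$ to vectors (all columns, or all rows, of the same dimension). A sentence is an expression whose value is a $1\times1$ matrix for every input. For two finite undirected graphs without self-loops $G,H$ of the same order, with adjacency matrices $A_G,A_H$, write $G\equiv_{\mathsf{ML}(\mathcal L)}H$ if $e(A_G)=e(A_H)$ for all sentences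 $e(X)$ in $\mathsf{ML}(\mathcal L)$. Let $\Omega=\bigcup_{p>0}\Omega_p$, where each $\Omega_p$ is an arbitrary set of functions $\mathbb C^p\to\mathbb C$, and let $G$ and $H$ be two graphs of the same order. Then 1. $G\equiv_{\mathsf{ML}(\cdot,{}^*,\mathbb 1,\mathsf{diag})}H$ if and only if $G\equiv_{\mathsf{ML}(\cdot,{}^*,\mathbb 1,\mathsf{diag},+,\times,\mathsf{Apply}_{\mathsf s}[f],\mathsf{Apply}_{\mathsf v}[f],f\in\Omega)}H$; 2. $G\equiv_{\mathsf{ML}(\cdot,\mathsf{tr},{}^*,\mathbb 1,\mathsf{diag})}H$ if and only if $G\equiv_{\mathsf{ML}(\cdot,\mathsf{tr},{}^*,\mathbb 1,\mathsf{diag},+,\times,\mathsf{Apply}_{\mathsf s}[f],\mathsf{Apply}_{\mathsf v}[f],f\in\Omega)}H$. -/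

import Mathlib

open scoped Matrix

/-- Size symbols of the type system of matrix query languages: the constant `1`, and the symbol
that stands for the order of the (square) input matrix. -/
inductive MatLang.Dim : Type
  | one : MatLang.Dim
  | order : MatLang.Dim

/-- The value of a size symbol when the input matrix is `n × n`. -/
def MatLang.Dim.size (n : ℕ) : MatLang.Dim → ℕ
  | .one => 1
  | .order => n

/-- The types of column vectors and of row vectors. -/
def MatLang.IsVectorType (a b : MatLang.Dim) : Prop :=
  (a = .order ∧ b = .one) ∨ (a = .one ∧ b = .order)

/-- The linear algebra operations. `applyS f` and `applyV f` are pointwise application of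
`f : ℂᵖ → ℂ` restricted to scalars and restricted to vectors, respectively. -/
inductive MatLang.Op : Type
  | mul : MatLang.Op
  | conjTranspose : MatLang.Op
  | ones : MatLang.Op
  | diag : MatLang.Op
  | trace : MatLang.Op
  | add : MatLang.Op
  | smul : MatLang.Op
  | applyS {p : ℕ} (f : (Fin p → ℂ) → ℂ) : MatLang.Op
  | applyV {p : ℕ} (f : (Fin p → ℂ) → ℂ) : MatLang.Op

/-- `MatLang.Expr L a b`: the well-formed expressions `e(X)` of type `a × b` in the single matrix
variable `X`, built with the operations in `L` only. The variable `X` stands for a square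
matrix. -/
inductive MatLang.Expr (L : Set MatLang.Op) : MatLang.Dim → MatLang.Dim → Type
  | var : MatLang.Expr L .order .order
  | mul {a b c : MatLang.Dim} (h : MatLang.Op.mul ∈ L)
      (e₁ : MatLang.Expr L a b) (e₂ : MatLang.Expr L b c) : MatLang.Expr L a c
  | conjTranspose {a b : MatLang.Dim} (h : MatLang.Op.conjTranspose ∈ L)
      (e : MatLang.Expr L a b) : MatLang.Expr L b a
  | ones {a b : MatLang.Dim} (h : MatLang.Op.ones ∈ L)
      (e : MatLang.Expr L a b) : MatLang.Expr L a .one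
  | diag {a : MatLang.Dim} (h : MatLang.Op.diag ∈ L)
      (e : MatLang.Expr L a .one) : MatLang.Expr L a a
  | trace {a : MatLang.Dim} (h : MatLang.Op.trace ∈ L)
      (e : MatLang.Expr L a a) : MatLang.Expr L .one .one
  | add {a b : MatLang.Dim} (h : MatLang.Op.add ∈ L)
      (e₁ e₂ : MatLang.Expr L a b) : MatLang.Expr L a b
  | smul {a b : MatLang.Dim} (h : MatLang.Op.smul ∈ L) (c : ℂ)
      (e : MatLang.Expr L a b) : MatLang.Expr L a b
  | applyS {p : ℕ} (f : (Fin p → ℂ) → ℂ) (h : MatLang.Op.applyS f ∈ L)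
      (e : Fin p → MatLang.Expr L .one .one) : MatLang.Expr L .one .one
  | applyV {a b : MatLang.Dim} (hab : MatLang.IsVectorType a b)
      {p : ℕ} (f : (Fin p → ℂ) → ℂ) (h : MatLang.Op.applyV f ∈ L)
      (e : Fin p → MatLang.Expr L a b) : MatLang.Expr L a b

/-- The value `e(A)` of the expression `e(X)` on the matrix `A`. -/
noncomputable def MatLang.Expr.eval {L : Set MatLang.Op} {n : ℕ} (A : Matrix (Fin n) (Fin n) ℂ) :
    {a b : MatLang.Dim} → MatLang.Expr L a b →
      Matrix (Fin (a.size n)) (Fin (b.size n)) ℂ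
  | _, _, .var => A
  | _, _, .mul _ e₁ e₂ => e₁.eval A * e₂.eval A
  | _, _, .conjTranspose _ e => (e.eval A)ᴴ
  | _, _, .ones _ _ => Matrix.of fun _ _ => 1
  | _, _, .diag _ e => Matrix.diagonal fun i => e.eval A i (0 : Fin 1)
  | _, _, .trace _ e => Matrix.of fun _ _ => (e.eval A).trace
  | _, _, .add _ e₁ e₂ => e₁.eval A + e₂.eval A
  | _, _, .smul _ c e => c • e.eval A
  | _, _, .applyS f _ e => Matrix.of fun i j => f fun k => (e k).eval A i j
  | _, _, .applyV _ f _ e => Matrix.of fun i j => f fun k => (e k).eval A i j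

/-- A sentence is an expression whose value is a `1 × 1` matrix for every input. -/
abbrev MatLang.Sentence (L : Set MatLang.Op) : Type := MatLang.Expr L .one .one

/-- Two matrices are equivalent for a fragment if no sentence of it distinguishes them. -/
def MatLang.MatrixEquiv (L : Set MatLang.Op) {n : ℕ} (A B : Matrix (Fin n) (Fin n) ℂ) : Prop :=
  ∀ e : MatLang.Sentence L, e.eval A = e.eval B

/-- Two graphs of the same order are equivalent for a fragment if their adjacency matrices are. -/
def MatLang.GraphEquiv (L : Set MatLang.Op) {n : ℕ} (G H : SimpleGraph (Fin n))
    [DecidableRel G.Adj] [DecidableRel H.Adj] : Prop :=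
  MatLang.MatrixEquiv L (G.adjMatrix ℂ) (H.adjMatrix ℂ)

/-- The operations `Apply_s[f]` and `Apply_v[f]` for `f ∈ Ω`, where `Ω` consists of sets `Ω p` of
functions `ℂᵖ → ℂ` for `p > 0`. -/
def MatLang.pointwiseOps (Ω : (p : ℕ) → Set ((Fin p → ℂ) → ℂ)) : Set MatLang.Op :=
  {o | ∃ p : ℕ, 0 < p ∧ ∃ f ∈ Ω p, o = MatLang.Op.applyS f ∨ o = MatLang.Op.applyV f}

/-! Equivalence is transferred through the span of the joint values `(e(A), e(B))`, where both
components carry the same coefficients. Product, conjugate transpose, `diag` and trace are bilinear,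
linear or conjugate-linear, so they preserve this span, and addition and scaling are absorbed by it.
For pointwise application, a pair of column vectors is a function on the disjoint union of two index
sets. Since `diag(v) * w` is the entrywise product, the pairs in the span form a unital subalgebra.
A subalgebra of functions on a finite set contains every function constant on its classes of
unseparated points (`Subalgebra.mem_of_forall_not_separated`), hence `f(v₁, …, vₚ)` for an arbitrary
`f`. Scalar pairs in the span have equal components, because those of the generators do. -/

/-! ### Subalgebras of functions on a finite set -/

/-- A function on a finite type belongs to a subalgebra of functions as soon as it identifies all
points that the subalgebra does not separate. -/
theorem Subalgebra.mem_of_forall_not_separated {ι K : Type*} [Finite ι] [Field K] [CharZero K]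
    (S : Subalgebra K (ι → K)) (g : ι → K)
    (hg : ∀ i j, (∀ s ∈ S, s i = s j) → g i = g j) : g ∈ S := by
  classical
  cases nonempty_fintype ι
  let r : ι → ι → Prop := fun i j => ∀ s ∈ S, s i = s j
  have separate : ∀ j i, ∃ s ∈ S, s j = 1 ∧ (¬ r i j → s i = 0) := by
    intro j i
    by_cases h : r i j
    · exact ⟨1, S.one_mem, rfl, fun h' => absurd h h'⟩
    · obtain ⟨s, hs, hij⟩ : ∃ s ∈ S, s i ≠ s j := by simpa [r] using h
      -- A separating function is normalised affinely to be 0 at `i` and 1 at `j`.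
      refine ⟨(s j - s i)⁻¹ • (s - algebraMap K (ι → K) (s i)),
        S.smul_mem (S.sub_mem hs (S.algebraMap_mem _)) _, ?_, fun _ => ?_⟩
      · simpa using inv_mul_cancel₀ (sub_ne_zero.2 hij.symm)
      · simp
  choose s hs hs1 hs0 using separate
  let δ : ι → ι → K := fun j => ∏ i, s j i
  have hδ : ∀ j, δ j ∈ S := fun j => S.prod_mem fun i _ => hs j i
  have δ_apply : ∀ j l, δ j l = if r l j then 1 else 0 := by
    intro j l
    split_ifs with h
    · rw [h _ (hδ j)]
      simp [δ, hs1]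
    · simp only [δ, Finset.prod_apply]
      exact Finset.prod_eq_zero (Finset.mem_univ l) (hs0 j l h)
  -- Each class indicator `δ j` occurs once per member of its class; dividing by the class size `c`,
  -- nonzero in characteristic zero, avoids choosing representatives.
  let c : ι → K := ∑ j, δ j
  have c_apply : ∀ l, c l = (Finset.univ.filter fun j => r l j).card := by
    intro l
    simp [c, δ_apply]
  have c_congr : ∀ l j, r l j → c l = c j := fun l j h => h _ (S.sum_mem fun i _ => hδ i)
  have c_ne : ∀ l, c l ≠ 0 := by
    intro l
    rw [c_apply, Nat.cast_ne_zero]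
    exact Finset.card_ne_zero_of_mem (a := l) (by simp [r])
  have key : g = ∑ j, (g j / c j) • δ j := by
    funext l
    have : ∀ j, (g j / c j) * δ j l = (g l / c l) * δ j l := by
      intro j
      rw [δ_apply]
      split_ifs with h
      · rw [hg l j h, c_congr l j h]
      · simp
    simp only [Finset.sum_apply, Pi.smul_apply, smul_eq_mul, this, ← Finset.mul_sum]
    have hc : ∑ j, δ j l = c l := by simp [c]
    rw [hc, div_mul_cancel₀ _ (c_ne l)]
  rw [key]
  exact S.sum_mem fun j _ => S.smul_mem (hδ j) _

/-! ### Monotonicity in the set of operations -/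

namespace MatLang

/-- An expression over fewer operations, read as an expression over more operations. -/
def Expr.mono {L L' : Set Op} (hL : L ⊆ L') : {a b : Dim} → Expr L a b → Expr L' a b
  | _, _, .var => .var
  | _, _, .mul h e₁ e₂ => .mul (hL h) (e₁.mono hL) (e₂.mono hL)
  | _, _, .conjTranspose h e => .conjTranspose (hL h) (e.mono hL)
  | _, _, .ones h e => .ones (hL h) (e.mono hL)
  | _, _, .diag h e => .diag (hL h) (e.mono hL)
  | _, _, .trace h e => .trace (hL h) (e.mono hL)
  | _, _, .add h e₁ e₂ => .add (hL h) (e₁.mono hL) (e₂.mono hL)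
  | _, _, .smul h c e => .smul (hL h) c (e.mono hL)
  | _, _, .applyS f h e => .applyS f (hL h) fun k => (e k).mono hL
  | _, _, .applyV hab f h e => .applyV hab f (hL h) fun k => (e k).mono hL

theorem Expr.eval_mono {L L' : Set Op} (hL : L ⊆ L') {n : ℕ} (A : Matrix (Fin n) (Fin n) ℂ)
    {a b : Dim} (e : Expr L a b) : (e.mono hL).eval A = e.eval A := by
  induction e with
  | var => rfl
  | _ => simp_all [Expr.mono, Expr.eval]

theorem MatrixEquiv.anti {L L' : Set Op} (hL : L ⊆ L') {n : ℕ} {A B : Matrix (Fin n) (Fin n) ℂ}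
    (h : MatrixEquiv L' A B) : MatrixEquiv L A B := fun e => by
  simpa only [Expr.eval_mono] using h (e.mono hL)

/-! ### Closure of the span of joint values -/

section ValueSpan

variable {L : Set Op} {n : ℕ} {A B : Matrix (Fin n) (Fin n) ℂ} {a b c : Dim}

/-- The span of the simultaneous values `(e(A), e(B))` of the expressions of type `a × b`. -/
def valueSpan (L : Set Op) {n : ℕ} (A B : Matrix (Fin n) (Fin n) ℂ) (a b : Dim) :
    Submodule ℂ (Matrix (Fin (a.size n)) (Fin (b.size n)) ℂ ×
      Matrix (Fin (a.size n)) (Fin (b.size n)) ℂ) :=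
  Submodule.span ℂ (Set.range fun e : Expr L a b => (e.eval A, e.eval B))

theorem eval_mem_valueSpan (e : Expr L a b) : (e.eval A, e.eval B) ∈ valueSpan L A B a b :=
  Submodule.subset_span ⟨e, rfl⟩

theorem mul_mem_valueSpan (h : Op.mul ∈ L)
    {x : Matrix (Fin (a.size n)) (Fin (b.size n)) ℂ × Matrix (Fin (a.size n)) (Fin (b.size n)) ℂ}
    {y : Matrix (Fin (b.size n)) (Fin (c.size n)) ℂ × Matrix (Fin (b.size n)) (Fin (c.size n)) ℂ}
    (hx : x ∈ valueSpan L A B a b) (hy : y ∈ valueSpan L A B b c) :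
    (x.1 * y.1, x.2 * y.2) ∈ valueSpan L A B a c := by
  induction hx using Submodule.span_induction with
  | mem x hx =>
    obtain ⟨e, rfl⟩ := hx
    induction hy using Submodule.span_induction with
    | mem y hy =>
      obtain ⟨e', rfl⟩ := hy
      exact eval_mem_valueSpan (.mul h e e')
    | zero => simp [← Prod.zero_eq_mk]
    | add y z _ _ hy hz => simpa [Matrix.mul_add] using add_mem hy hz
    | smul t y _ hy => simpa using (valueSpan L A B a c).smul_mem t hy
  | zero => simp [← Prod.zero_eq_mk]
  | add x z _ _ hx hz => simpa [Matrix.add_mul] using add_mem hx hz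
  | smul t x _ hx => simpa using (valueSpan L A B a c).smul_mem t hx

theorem conjTranspose_mem_valueSpan (h : Op.conjTranspose ∈ L)
    {x : Matrix (Fin (a.size n)) (Fin (b.size n)) ℂ × Matrix (Fin (a.size n)) (Fin (b.size n)) ℂ}
    (hx : x ∈ valueSpan L A B a b) : (x.1ᴴ, x.2ᴴ) ∈ valueSpan L A B b a := by
  induction hx using Submodule.span_induction with
  | mem x hx =>
    obtain ⟨e, rfl⟩ := hx
    exact eval_mem_valueSpan (.conjTranspose h e)
  | zero => simp [← Prod.zero_eq_mk]
  | add x z _ _ hx hz => simpa using add_mem hx hz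
  | smul t x _ hx => simpa using (valueSpan L A B b a).smul_mem (star t) hx

theorem diag_mem_valueSpan (h : Op.diag ∈ L)
    {x : Matrix (Fin (a.size n)) (Fin (Dim.one.size n)) ℂ ×
      Matrix (Fin (a.size n)) (Fin (Dim.one.size n)) ℂ}
    (hx : x ∈ valueSpan L A B a .one) :
    (Matrix.diagonal fun i => x.1 i (0 : Fin 1), Matrix.diagonal fun i => x.2 i (0 : Fin 1)) ∈
      valueSpan L A B a a := by
  induction hx using Submodule.span_induction with
  | mem x hx =>
    obtain ⟨e, rfl⟩ := hx
    exact eval_mem_valueSpan (.diag h e)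
  | zero =>
    convert (valueSpan L A B a a).zero_mem using 1
    ext i j <;> by_cases hij : i = j <;> simp [hij] <;> rfl
  | add x z _ _ hx hz =>
    convert add_mem hx hz using 1
    ext i j <;> by_cases hij : i = j <;> simp [hij] <;> rfl
  | smul t x _ hx =>
    convert (valueSpan L A B a a).smul_mem t hx using 1
    ext i j <;> by_cases hij : i = j <;> simp [hij] <;> rfl

theorem trace_mem_valueSpan (h : Op.trace ∈ L)
    {x : Matrix (Fin (a.size n)) (Fin (a.size n)) ℂ × Matrix (Fin (a.size n)) (Fin (a.size n)) ℂ}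
    (hx : x ∈ valueSpan L A B a a) :
    ((Matrix.of fun _ _ => x.1.trace, Matrix.of fun _ _ => x.2.trace) :
      Matrix (Fin (Dim.one.size n)) (Fin (Dim.one.size n)) ℂ ×
        Matrix (Fin (Dim.one.size n)) (Fin (Dim.one.size n)) ℂ) ∈ valueSpan L A B .one .one := by
  induction hx using Submodule.span_induction with
  | mem x hx =>
    obtain ⟨e, rfl⟩ := hx
    exact eval_mem_valueSpan (.trace h e)
  | zero =>
    convert (valueSpan L A B .one .one).zero_mem using 1
    ext <;> simp
  | add x z _ _ hx hz =>
    convert add_mem hx hz using 1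
    ext <;> simp
  | smul t x _ hx =>
    convert (valueSpan L A B .one .one).smul_mem t hx using 1
    ext <;> simp

theorem ones_mem_valueSpan (h : Op.ones ∈ L) (h' : Op.conjTranspose ∈ L) (a : Dim) :
    ((Matrix.of fun _ _ => 1, Matrix.of fun _ _ => 1) :
      Matrix (Fin (a.size n)) (Fin (Dim.one.size n)) ℂ ×
        Matrix (Fin (a.size n)) (Fin (Dim.one.size n)) ℂ) ∈ valueSpan L A B a .one := by
  cases a with
  -- The height 1 comes from the row vector of ones, so conjugate transposition is needed.
  | one => exact eval_mem_valueSpan (.ones h (.conjTranspose h' (.ones h .var)))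
  | order => exact eval_mem_valueSpan (.ones h .var)

/-- The only place where the equivalence of `A` and `B` enters: the pairs with equal components form
a subspace. -/
theorem fst_eq_snd_of_mem_valueSpan (hAB : MatrixEquiv L A B)
    {x : Matrix (Fin (Dim.one.size n)) (Fin (Dim.one.size n)) ℂ ×
      Matrix (Fin (Dim.one.size n)) (Fin (Dim.one.size n)) ℂ}
    (hx : x ∈ valueSpan L A B .one .one) : x.1 = x.2 := by
  induction hx using Submodule.span_induction with
  | mem x hx =>
    obtain ⟨e, rfl⟩ := hx
    exact hAB e
  | zero => rfl
  | add x z _ _ hx hz => simp [hx, hz]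
  | smul t x _ hx => simp [hx]

/-- The column vectors in the span of the simultaneous values, as an algebra under the entrywise
operations. -/
def vectorSubalgebra (A B : Matrix (Fin n) (Fin n) ℂ) (hmul : Op.mul ∈ L)
    (hstar : Op.conjTranspose ∈ L) (hones : Op.ones ∈ L) (hdiag : Op.diag ∈ L) (a : Dim) :
    Subalgebra ℂ (Fin (a.size n) ⊕ Fin (a.size n) → ℂ) where
  carrier := {g | ((Matrix.of fun i _ => g (.inl i), Matrix.of fun i _ => g (.inr i)) :
    Matrix (Fin (a.size n)) (Fin (Dim.one.size n)) ℂ ×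
      Matrix (Fin (a.size n)) (Fin (Dim.one.size n)) ℂ) ∈ valueSpan L A B a .one}
  mul_mem' {g k} hg hk := by
    change _ ∈ valueSpan L A B a .one
    convert mul_mem_valueSpan hmul (diag_mem_valueSpan hdiag hg) hk using 1
    ext <;> simp <;> exact Or.inl rfl
  add_mem' {g k} hg hk := by
    exact (valueSpan L A B a .one).add_mem hg hk
  algebraMap_mem' t := by
    change _ ∈ valueSpan L A B a .one
    convert (valueSpan L A B a .one).smul_mem t (ones_mem_valueSpan hones hstar a) using 1
    ext <;> simp

theorem apply_mem_valueSpan (hmul : Op.mul ∈ L)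
    (hstar : Op.conjTranspose ∈ L) (hones : Op.ones ∈ L) (hdiag : Op.diag ∈ L)
    {p : ℕ} (f : (Fin p → ℂ) → ℂ)
    (x : Fin p → Matrix (Fin (a.size n)) (Fin (Dim.one.size n)) ℂ ×
      Matrix (Fin (a.size n)) (Fin (Dim.one.size n)) ℂ)
    (hx : ∀ k, x k ∈ valueSpan L A B a .one) :
    (Matrix.of fun i j => f fun k => (x k).1 i j, Matrix.of fun i j => f fun k => (x k).2 i j) ∈
      valueSpan L A B a .one := by
  let S := vectorSubalgebra A B hmul hstar hones hdiag a
  let v : Fin p → Fin (a.size n) ⊕ Fin (a.size n) → ℂ := fun k =>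
    Sum.elim (fun i => (x k).1 i (0 : Fin 1)) (fun i => (x k).2 i (0 : Fin 1))
  have hv : ∀ k, v k ∈ S := by
    intro k
    change _ ∈ valueSpan L A B a .one
    convert hx k using 1
    ext i j <;> rw [Subsingleton.elim (α := Fin 1) j 0] <;> rfl
  -- Points that `S` does not separate, even one from each half, agree on every `v k`, hence on `f`
  -- of them.
  have hf : (fun i => f fun k => v k i) ∈ S :=
    S.mem_of_forall_not_separated _ fun i j hij => by
      simp only [fun k => hij (v k) (hv k)]
  change _ ∈ valueSpan L A B a .one at hf
  convert hf using 1
  ext i j <;> rw [Subsingleton.elim (α := Fin 1) j 0] <;> rfl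

/-- Linear combinations of values are closed under all operations, except that the trace has to be
available already. For scalar arguments, pointwise application is the case `a = 1` of
`apply_mem_valueSpan`. -/
theorem eval_mem_valueSpan_of_trace {L' : Set Op} (hmul : Op.mul ∈ L)
    (hstar : Op.conjTranspose ∈ L) (hones : Op.ones ∈ L) (hdiag : Op.diag ∈ L)
    (htrace : Op.trace ∈ L' → Op.trace ∈ L) (e : Expr L' a b) :
    (e.eval A, e.eval B) ∈ valueSpan L A B a b := by
  induction e with
  | var => exact eval_mem_valueSpan .var
  | mul _ _ _ h₁ h₂ =>
    simp only [Expr.eval]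
    have key := mul_mem_valueSpan hmul h₁ h₂
    exact key
  | conjTranspose _ _ h =>
    simp only [Expr.eval]
    have key := conjTranspose_mem_valueSpan hstar h
    exact key
  | ones _ _ _ =>
    simp only [Expr.eval]
    exact ones_mem_valueSpan hones hstar _
  | diag _ _ h =>
    simp only [Expr.eval]
    have key := diag_mem_valueSpan hdiag h
    exact key
  | trace ht _ h =>
    simp only [Expr.eval]
    have key := trace_mem_valueSpan (htrace ht) h
    exact key
  | add _ _ _ h₁ h₂ =>
    simp only [Expr.eval]
    have key := Submodule.add_mem _ h₁ h₂
    exact key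
  | smul _ t _ h =>
    simp only [Expr.eval]
    have key := Submodule.smul_mem _ t h
    exact key
  | applyS f _ e h =>
    simp only [Expr.eval]
    have key := apply_mem_valueSpan hmul hstar hones hdiag f (fun k => ((e k).eval A, (e k).eval B)) h
    exact key
  | applyV hab f _ e h =>
    simp only [Expr.eval]
    rcases hab with ⟨rfl, rfl⟩ | ⟨rfl, rfl⟩
    · exact apply_mem_valueSpan hmul hstar hones hdiag f (fun k => ((e k).eval A, (e k).eval B)) h
    -- Row vectors become columns only with conjugated entries, so `f` is conjugated on both sides
    -- to compensate.
    · have key := conjTranspose_mem_valueSpan hstar <|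
        apply_mem_valueSpan hmul hstar hones hdiag (fun z => star (f fun k => star (z k))) _
          fun k => conjTranspose_mem_valueSpan hstar (h k)
      convert key using 1
      ext i j <;> simp

end ValueSpan

/-! ### Transfer of equivalence between fragments -/

/-- Once multiplication, conjugate transposition, the one-vector and `diag` are available, only the
trace can add distinguishing power. -/
theorem MatrixEquiv.of_trace {L L' : Set Op} {n : ℕ} {A B : Matrix (Fin n) (Fin n) ℂ}
    (hmul : Op.mul ∈ L) (hstar : Op.conjTranspose ∈ L) (hones : Op.ones ∈ L)
    (hdiag : Op.diag ∈ L) (htrace : Op.trace ∈ L' → Op.trace ∈ L) (h : MatrixEquiv L A B) :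
    MatrixEquiv L' A B := fun e =>
  fst_eq_snd_of_mem_valueSpan h
    (eval_mem_valueSpan_of_trace hmul hstar hones hdiag htrace e)

theorem trace_notMem_pointwiseOps (Ω : (p : ℕ) → Set ((Fin p → ℂ) → ℂ)) :
    Op.trace ∉ pointwiseOps Ω := by
  rintro ⟨p, _, f, _, h | h⟩ <;> cases h

end MatLang

open MatLang in
theorem mainTheorem12 (Ω : (p : ℕ) → Set ((Fin p → ℂ) → ℂ)) (n : ℕ)
    (G H : SimpleGraph (Fin n)) [DecidableRel G.Adj] [DecidableRel H.Adj] :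
    (GraphEquiv {Op.mul, Op.conjTranspose, Op.ones, Op.diag} G H ↔
      GraphEquiv ({Op.mul, Op.conjTranspose, Op.ones, Op.diag, Op.add, Op.smul} ∪
        pointwiseOps Ω) G H) ∧
    (GraphEquiv {Op.mul, Op.trace, Op.conjTranspose, Op.ones, Op.diag} G H ↔
      GraphEquiv ({Op.mul, Op.trace, Op.conjTranspose, Op.ones, Op.diag, Op.add, Op.smul} ∪
        pointwiseOps Ω) G H) := by
  refine ⟨⟨MatrixEquiv.of_trace (by simp) (by simp) (by simp) (by simp) ?_,
    MatrixEquiv.anti ?_⟩, ⟨MatrixEquiv.of_trace (by simp) (by simp) (by simp) (by simp) ?_,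
    MatrixEquiv.anti ?_⟩⟩
  · simp [trace_notMem_pointwiseOps]
  · intro o ho
    simp only [Set.mem_insert_iff, Set.mem_singleton_iff, Set.mem_union] at ho ⊢
    tauto
  · simp
  · intro o ho
    simp only [Set.mem_insert_iff, Set.mem_singleton_iff, Set.mem_union] at ho ⊢
    tauto
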